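/- Let $X$, $Y$ be real or complex Banach spaces and let $T\colon X\to Y$ be a bounded linear operator with adjoint $T^*\colon Y^*\to X^*$. Let $B_X$ be the closed unit ball of $X$, and regard $Y$ as canonically embedded in its bidual $Y^{**}$. For subsets $A,B$ of a Banach space $Z$ put $\hat d(A,B)=\sup_{a\in A}\operatorname{dist}(a,B)$. For bounded $A\subset Z$ let $$\chi(A)=\inf\{\hat d(A,K):\ \emptyset\ne K\subset Z\text{ compact}\},\qquad \omega(A)=\inf\{\hat d(A,K):\ \emptyset\ne K\subset Z\text{ weakly compact}\},$$ $$\operatorname{wk}_Z(A)=\hat d\big(\overline{A}^{\,w^*},Z\big),$$ where $\overline{A}^{\,w^*}$ is the weak$^*$ closure of $A$ in $Z^{**}$. Put $\chi(T)=\chi(T(B_X))$, $\omega(T)=\omega(T(B_X))$, $\operatorname{wk}_Y(T)=\operatorname{wk}_Y(T(B_X))$ and $\omega(T^*)=\omega(T^*(B_{Y^*}))$. For a bounded sequence $(z_n)$ put $\operatorname{ca}((z_n))=\inf_n\sup_{k,l\ge n}\|z_k-z_l\|$. A sequence in $X$ is Right-Cauchy if it is Cauchy in the topology of uniform convergence on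 the weakly compact subsets of $X^*$. Define $$\operatorname{uc}(T)=\sup\Big\{\operatorname{ca}\Big(\Big(\sum_{i=1}^nTx_i\Big)_n\Big):\ (x_n)\subset X,\ \sup_{x^*\in B_{X^*}}\sum_{n=1}^\infty|x^*(x_n)|\le 1\Big\},$$ $$\operatorname{cc}(T)=\sup\operatorname{ca}((Tx_n)),\qquad \operatorname{wcc}(T)=\sup\operatorname{dist}\big(w^*\text{-}\lim Tx_n,\,Y\big),\qquad \operatorname{wcc}_\omega(T)=\sup\omega(\{Tx_n:\ n\in\mathbb N\}),$$ the last three suprema being over all weakly Cauchy sequences $(x_n)$ in $B_X$, where $w^*\text{-}\lim Tx_n$ is the weak$^*$ limit in $Y^{**}$ (it always exists). Let $\operatorname{cc}_\rho(T)$, $\operatorname{Rcc}(T)$, $\operatorname{Rcc}_\omega(T)$ be defined by the same three formulas, respectively, with the suprema over all Right-Cauchy sequences $(x_n)$ in $B_X$. Then all of the following inequalities hold: $$\operatorname{cc}_\rho(T)\le 2\,\omega(T^*),\qquad \operatorname{cc}_\rho(T)\le\operatorname{cc}(T)\le 4\,\chi(T),$$ $$\operatorname{Rcc}_\omega(T)\le\operatorname{cc}_\rho(T),\qquad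 \operatorname{wcc}_\omega(T)\le\operatorname{cc}(T),\qquad \omega(T)\le\chi(T),$$ $$\operatorname{Rcc}_\omega(T)\le\operatorname{wcc}_\omega(T)\le\omega(T),$$ $$\operatorname{Rcc}(T)\le\operatorname{Rcc}_\omega(T),\qquad \operatorname{wcc}(T)\le\operatorname{wcc}_\omega(T),\qquad \operatorname{wk}_Y(T)\le\omega(T),$$ $$\tfrac14\operatorname{uc}(T)\le\operatorname{Rcc}(T)\le\operatorname{wcc}(T)\le\operatorname{wk}_Y(T).$$ -/

import Mathlib

open Filter Topology
open scoped ENNReal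

noncomputable section

namespace OperatorQuantity

/-! All quantities take values in `[0, ∞]`, so that suprema, infima and distances carry no
junk values. -/

section Sets

variable (𝕜 : Type*) [RCLike 𝕜] {E : Type*} [NormedAddCommGroup E] [NormedSpace 𝕜 E]

/-- The set `K` is compact in the weak topology `σ(E, E*)`. -/
def IsWeaklyCompact (K : Set E) : Prop :=
  IsCompact (toWeakSpace 𝕜 E '' K)

/-- The non-symmetrized Hausdorff distance `sup_{a ∈ A} dist(a, B)`. -/
def hausdorffExcess {M : Type*} [PseudoEMetricSpace M] (A B : Set M) : ℝ≥0∞ :=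
  ⨆ a ∈ A, Metric.infEDist a B

/-- The Hausdorff measure of non-compactness of a set. -/
def chiSet {M : Type*} [PseudoEMetricSpace M] (A : Set M) : ℝ≥0∞ :=
  ⨅ (K : Set M) (_ : K.Nonempty) (_ : IsCompact K), hausdorffExcess A K

/-- The de Blasi measure of weak non-compactness of a set. -/
def omegaSet (A : Set E) : ℝ≥0∞ :=
  ⨅ (K : Set E) (_ : K.Nonempty) (_ : IsWeaklyCompact 𝕜 K), hausdorffExcess A K

/-- The canonical copy of `E` in its bidual `E**`, with the norm of `E**`. -/
def canonicalCopy (E : Type*) [NormedAddCommGroup E] [NormedSpace 𝕜 E] :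
    Set (StrongDual 𝕜 (StrongDual 𝕜 E)) :=
  Set.range (NormedSpace.inclusionInDoubleDual 𝕜 E)

/-- The closure of (the canonical image of) `A ⊆ E` in the bidual `E**` for the weak-star topology
`σ(E**, E*)`. -/
def weakStarClosure (A : Set E) : Set (StrongDual 𝕜 (StrongDual 𝕜 E)) :=
  StrongDual.toWeakDual ⁻¹'
    closure (StrongDual.toWeakDual '' (NormedSpace.inclusionInDoubleDual 𝕜 E '' A))

/-- `wk_E(A)`: how far the weak-star closure of `A` in the bidual sticks out of `E`. -/
def wkSet (A : Set E) : ℝ≥0∞ :=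
  hausdorffExcess (weakStarClosure 𝕜 A) (canonicalCopy 𝕜 E)

/-- `(x n)` is Cauchy in the weak topology. -/
def WeaklyCauchy (x : ℕ → E) : Prop :=
  ∀ f : StrongDual 𝕜 E, CauchySeq fun n => f (x n)

/-- `(x n)` is Cauchy in the Right topology `ρ` of `E`, the topology of uniform convergence on the
weakly compact subsets of `E*`. -/
def RightCauchy (x : ℕ → E) : Prop :=
  ∀ K : Set (StrongDual 𝕜 E), IsWeaklyCompact 𝕜 K →
    UniformCauchySeqOn (fun (n : ℕ) (f : StrongDual 𝕜 E) => f (x n)) atTop K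

/-- `z ∈ E**` is the weak-star limit of the sequence `(y n)` in `E`. -/
def IsWeakStarLim (y : ℕ → E) (z : StrongDual 𝕜 (StrongDual 𝕜 E)) : Prop :=
  Tendsto (fun n => StrongDual.toWeakDual (NormedSpace.inclusionInDoubleDual 𝕜 E (y n)))
    atTop (𝓝 (StrongDual.toWeakDual z))

end Sets

/-- `ca((x n)) = inf_n sup_{k, l ≥ n} ‖x k - x l‖`, the measure of non-Cauchyness. -/
def ca {M : Type*} [PseudoEMetricSpace M] (x : ℕ → M) : ℝ≥0∞ :=
  ⨅ n : ℕ, ⨆ (k : ℕ) (_ : n ≤ k) (l : ℕ) (_ : n ≤ l), edist (x k) (x l)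

section Operators

variable {𝕜 : Type*} [RCLike 𝕜]
  {X : Type*} [NormedAddCommGroup X] [NormedSpace 𝕜 X]
  {Y : Type*} [NormedAddCommGroup Y] [NormedSpace 𝕜 Y]

/-- The image `T(B_X)` of the closed unit ball. -/
def ballImage (T : X →L[𝕜] Y) : Set Y :=
  T '' {x | ‖x‖ ≤ 1}

/-- The adjoint operator `T* : Y* → X*`, `T* f = f ∘ T`. -/
def adj (T : X →L[𝕜] Y) : StrongDual 𝕜 Y →L[𝕜] StrongDual 𝕜 X :=
  ContinuousLinearMap.precomp 𝕜 T

/-- `χ(T) = χ(T(B_X))`. -/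
def chi (T : X →L[𝕜] Y) : ℝ≥0∞ := chiSet (ballImage T)

/-- `ω(T) = ω(T(B_X))`. -/
def omega (T : X →L[𝕜] Y) : ℝ≥0∞ := omegaSet 𝕜 (ballImage T)

/-- `wk_Y(T) = wk_Y(T(B_X))`. -/
def wk (T : X →L[𝕜] Y) : ℝ≥0∞ := wkSet 𝕜 (ballImage T)

/-- `uc(T)`: the supremum of `ca((∑_{i ≤ n} T x_i)_n)` over all sequences `(x n)` in `X` with
`sup_{‖f‖ ≤ 1} ∑_n |f(x n)| ≤ 1`. -/
def uc (T : X →L[𝕜] Y) : ℝ≥0∞ :=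
  ⨆ (x : ℕ → X)
    (_ : (⨆ (f : StrongDual 𝕜 X) (_ : ‖f‖ ≤ 1), ∑' n, ‖f (x n)‖ₑ) ≤ 1),
    ca fun n => ∑ i ∈ Finset.range (n + 1), T (x i)

/-- `cc(T)`: the supremum of `ca((T x_n))` over weakly Cauchy sequences in `B_X`. -/
def cc (T : X →L[𝕜] Y) : ℝ≥0∞ :=
  ⨆ (x : ℕ → X) (_ : ∀ n, ‖x n‖ ≤ 1) (_ : WeaklyCauchy 𝕜 x), ca fun n => T (x n)

/-- `cc_ρ(T)`: the supremum of `ca((T x_n))` over Right-Cauchy sequences in `B_X`. -/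
def ccRho (T : X →L[𝕜] Y) : ℝ≥0∞ :=
  ⨆ (x : ℕ → X) (_ : ∀ n, ‖x n‖ ≤ 1) (_ : RightCauchy 𝕜 x), ca fun n => T (x n)

/-- `wcc(T)`: the supremum of `dist(w*-lim T x_n, Y)` over weakly Cauchy sequences in `B_X`. -/
def wcc (T : X →L[𝕜] Y) : ℝ≥0∞ :=
  ⨆ (x : ℕ → X) (_ : ∀ n, ‖x n‖ ≤ 1) (_ : WeaklyCauchy 𝕜 x)
    (z : StrongDual 𝕜 (StrongDual 𝕜 Y)) (_ : IsWeakStarLim 𝕜 (fun n => T (x n)) z),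
    Metric.infEDist z (canonicalCopy 𝕜 Y)

/-- `wcc_ω(T)`: the supremum of `ω({T x_n : n ∈ ℕ})` over weakly Cauchy sequences in `B_X`. -/
def wccOmega (T : X →L[𝕜] Y) : ℝ≥0∞ :=
  ⨆ (x : ℕ → X) (_ : ∀ n, ‖x n‖ ≤ 1) (_ : WeaklyCauchy 𝕜 x),
    omegaSet 𝕜 (Set.range fun n => T (x n))

/-- `Rcc(T)`: the supremum of `dist(w*-lim T x_n, Y)` over Right-Cauchy sequences in `B_X`. -/
def rcc (T : X →L[𝕜] Y) : ℝ≥0∞ :=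
  ⨆ (x : ℕ → X) (_ : ∀ n, ‖x n‖ ≤ 1) (_ : RightCauchy 𝕜 x)
    (z : StrongDual 𝕜 (StrongDual 𝕜 Y)) (_ : IsWeakStarLim 𝕜 (fun n => T (x n)) z),
    Metric.infEDist z (canonicalCopy 𝕜 Y)

/-- `Rcc_ω(T)`: the supremum of `ω({T x_n : n ∈ ℕ})` over Right-Cauchy sequences in `B_X`. -/
def rccOmega (T : X →L[𝕜] Y) : ℝ≥0∞ :=
  ⨆ (x : ℕ → X) (_ : ∀ n, ‖x n‖ ≤ 1) (_ : RightCauchy 𝕜 x),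
    omegaSet 𝕜 (Set.range fun n => T (x n))

end Operators

end OperatorQuantity

end

/-! The substantial estimate is the one on `uc`. A weakly unconditionally Cauchy series `∑ x j`
sends a functional `f` to `(f (x j))` in `ℓ¹`. On a weakly compact set of functionals this map is
weakly continuous, and the Schur property makes the `ℓ¹` tails uniformly small, so the partial sums
are Right-Cauchy (`IsWUC.rightCauchy`). On the weak-star compact dual ball of `Y`, the signed sums
of `∑ T x j` are only within `r` of weak-star continuous functions, namely evaluations at points of
`Y`; a quantitative Schur argument then bounds the tails by `2 r` (`IsWUC.ca_partialSum_le`). Both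
cases are instances of `exists_forall_tsum_tail_le`, and together they give `uc T ≤ 2 * rcc T`.

The other inequalities rest on approximation: `wkSet_le_omegaSet` uses weak-star compactness of `K +
c B` in the bidual, and the bounds by `ω(T*)` and `χ(T)` replace functionals or vectors by nearby
elements of a (weakly) compact set. What remains is monotonicity, or the fact that finite sets are
compact. -/

namespace OperatorQuantity

/-! ### Quantitative Schur property of `ℓ¹` -/

section Sequences

variable {𝕜 : Type*} [RCLike 𝕜]

lemma summable_mul_of_norm_le_one {a θ : ℕ → 𝕜} (ha : Summable fun j => ‖a j‖)
    (hθ : ∀ j, ‖θ j‖ ≤ 1) : Summable fun j => ‖θ j * a j‖ :=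
  ha.of_nonneg_of_le (fun _ => norm_nonneg _) fun j => by
    rw [norm_mul]
    exact mul_le_of_le_one_left (norm_nonneg _) (hθ j)

/-- Choosing the signs of `θ` outside a finite set recovers the `ℓ¹` norm up to finitely many
terms. -/
lemma exists_tsum_norm_le (a θ₀ : ℕ → 𝕜) (ha : Summable fun j => ‖a j‖) (hθ₀ : ∀ j, ‖θ₀ j‖ ≤ 1)
    (I : Finset ℕ) :
    ∃ θ : ℕ → 𝕜, (∀ j, ‖θ j‖ ≤ 1) ∧ (∀ j ∈ I, θ j = θ₀ j) ∧
      ∑' j, ‖a j‖ ≤ ‖∑' j, θ j * a j‖ + 2 * ∑ j ∈ I, ‖a j‖ := by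
  classical
  choose u hu hua using fun j => RCLike.exists_norm_eq_mul_self (a j)
  set θ : ℕ → 𝕜 := fun j => if j ∈ I then θ₀ j else u j with hθdef
  have hθ : ∀ j, ‖θ j‖ ≤ 1 := fun j => by
    by_cases h : j ∈ I <;> simp [hθdef, h, hθ₀, hu]
  refine ⟨θ, hθ, fun j hj => by simp [hθdef, hj], ?_⟩
  have hs : Summable fun j => θ j * a j := (summable_mul_of_norm_le_one ha hθ).of_norm
  have hs' : Summable fun j => ((‖a j‖ : ℝ) : 𝕜) := by
    apply Summable.of_norm
    simpa using ha
  -- Off `I` the sign `u j` turns `a j` into its modulus, so only the terms in `I` survive, each of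
  -- norm at most `2 * ‖a j‖`.
  have hdiff : ∑' j, (((‖a j‖ : ℝ) : 𝕜) - θ j * a j)
      = ∑ j ∈ I, (((‖a j‖ : ℝ) : 𝕜) - θ j * a j) :=
    tsum_eq_sum fun j hj => by simp [hθdef, hj, hua]
  rw [hs'.tsum_sub hs, sub_eq_iff_eq_add] at hdiff
  have hnonneg : 0 ≤ ∑' j, ‖a j‖ := tsum_nonneg fun _ => norm_nonneg _
  calc ∑' j, ‖a j‖ = ‖((∑' j, ‖a j‖ : ℝ) : 𝕜)‖ := by
        rw [RCLike.norm_ofReal, abs_of_nonneg hnonneg]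
    _ = ‖∑ j ∈ I, (((‖a j‖ : ℝ) : 𝕜) - θ j * a j) + ∑' j, θ j * a j‖ := by
        rw [RCLike.ofReal_tsum, hdiff]
    _ ≤ ‖∑ j ∈ I, (((‖a j‖ : ℝ) : 𝕜) - θ j * a j)‖ + ‖∑' j, θ j * a j‖ := norm_add_le _ _
    _ ≤ 2 * ∑ j ∈ I, ‖a j‖ + ‖∑' j, θ j * a j‖ := by
        gcongr
        rw [Finset.mul_sum]
        refine norm_sum_le_of_le _ fun j _ => (norm_sub_le _ _).trans ?_
        rw [RCLike.norm_ofReal, abs_of_nonneg (norm_nonneg _), norm_mul, two_mul]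
        gcongr
        exact mul_le_of_le_one_left (norm_nonneg _) (hθ j)
    _ = _ := add_comm _ _

/-- A quantitative form of the Schur property of `ℓ¹`. -/
theorem eventually_tsum_norm_le (c : ℕ → ℕ → 𝕜) (hc : ∀ k, Summable fun j => ‖c k j‖)
    (hc0 : ∀ j, Tendsto (fun k => c k j) atTop (𝓝 0)) {s : ℝ}
    (hs : ∀ θ : ℕ → 𝕜, (∀ j, ‖θ j‖ ≤ 1) → ∀ ε > 0, ∀ᶠ k in atTop, ‖∑' j, θ j * c k j‖ ≤ s + ε)
    {ε : ℝ} (hε : 0 < ε) :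
    ∀ᶠ k in atTop, ∑' j, ‖c k j‖ ≤ s + ε := by
  let D := Metric.closedBall (0 : 𝕜) 1
  have : CompactSpace D := isCompact_iff_compactSpace.1 (isCompact_closedBall 0 1)
  have hD : ∀ (θ : ℕ → D) j, ‖(θ j : 𝕜)‖ ≤ 1 := fun θ j => mem_closedBall_zero_iff.1 (θ j).2
  let F : ℕ → Set (ℕ → D) := fun N =>
    {θ | ∀ k, N ≤ k → ‖∑' j, (θ j : 𝕜) * c k j‖ ≤ s + ε / 2}
  -- Baire category on the compact space of sign sequences: the closed sets `F N` cover it, so one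
  -- of them has interior.
  have hFclosed : ∀ N, IsClosed (F N) := fun N => by
    simp only [F, Set.ofPred_forall]
    refine isClosed_iInter fun k => isClosed_iInter fun _ => ?_
    refine isClosed_le (Continuous.norm ?_) continuous_const
    refine continuous_tsum (fun j => by fun_prop) (hc k) fun j θ => ?_
    rw [norm_mul]
    exact mul_le_of_le_one_left (norm_nonneg _) (hD θ j)
  have hFunion : ⋃ N, F N = Set.univ := by
    refine Set.eq_univ_of_forall fun θ => Set.mem_iUnion.2 ?_
    exact eventually_atTop.1 (hs (fun j => θ j) (hD θ) (ε / 2) (half_pos hε))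
  have : Nonempty (ℕ → D) := ⟨fun _ => ⟨0, by simp [D]⟩⟩
  obtain ⟨N, θ₀, hθ₀⟩ := nonempty_interior_of_iUnion_of_closed hFclosed hFunion
  -- A basic open set constrains only the coordinates in the finite set `I`; the others can be
  -- adapted to each `c k`, and the contribution of `I` tends to zero.
  obtain ⟨I, U, hU, hsub⟩ := isOpen_pi_iff.1 isOpen_interior θ₀ hθ₀
  have hsum : Tendsto (fun k => 2 * ∑ j ∈ I, ‖c k j‖) atTop (𝓝 0) := by
    simpa using (tendsto_finsetSum I fun j _ => (hc0 j).norm).const_mul 2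
  filter_upwards [hsum.eventually_le_const (half_pos hε), eventually_ge_atTop N] with k hk hNk
  obtain ⟨θ, hθ, hθI, hle⟩ := exists_tsum_norm_le (c k) (fun j => θ₀ j) (hc k) (hD θ₀) I
  have hmem : (fun j => (⟨θ j, mem_closedBall_zero_iff.2 (hθ j)⟩ : D)) ∈ F N := by
    refine interior_subset (hsub fun j hj => ?_)
    have : (⟨θ j, mem_closedBall_zero_iff.2 (hθ j)⟩ : D) = θ₀ j := Subtype.ext (hθI j hj)
    rw [this]
    exact (hU j hj).2
  have := hmem k hNk
  dsimp only at this
  linarith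

/-- If `Φ` maps a compact space `P` into `ℓ¹`, coordinatewise continuously, and all functionals
`p ↦ ∑ θ j * Φ p j` are within `r` of a continuous function on `P`, then the tails of the series
`∑ ‖Φ p j‖` are eventually at most `2 r`, uniformly in `p`. -/
theorem exists_forall_tsum_tail_le {P : Type*} [TopologicalSpace P] [CompactSpace P]
    (Φ : P → ℕ → 𝕜) (hΦ : ∀ j, Continuous fun p => Φ p j)
    (hΦs : ∀ p, Summable fun j => ‖Φ p j‖) {r : ℝ}
    (hw : ∀ θ : ℕ → 𝕜, (∀ j, ‖θ j‖ ≤ 1) →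
      ∃ w : P → 𝕜, Continuous w ∧ ∀ p, ‖∑' j, θ j * Φ p j - w p‖ ≤ r)
    {ε : ℝ} (hε : 0 < ε) :
    ∃ N, ∀ p, ∑' j, ‖Φ p (j + N)‖ ≤ 2 * r + ε := by
  by_contra! hcon
  choose p hp using hcon
  -- `P` need not be sequentially compact, but its image in the metrizable product is, so the
  -- subsequence converges only coordinatewise.
  obtain ⟨_, ⟨q, rfl⟩, φ, hφ, hlim⟩ := (isCompact_range (continuous_pi hΦ)).tendsto_subseq
    fun n => Set.mem_range_self (p n)
  have hlim' : ∀ j, Tendsto (fun k => Φ (p (φ k)) j) atTop (𝓝 (Φ q j)) :=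
    fun j => (tendsto_pi_nhds.1 hlim) j
  have hcs : ∀ k, Summable fun j => ‖Φ (p (φ k)) j - Φ q j‖ := fun k =>
    ((hΦs _).add (hΦs q)).of_nonneg_of_le (fun _ => norm_nonneg _) fun j => norm_sub_le _ _
  have hs : ∀ θ : ℕ → 𝕜, (∀ j, ‖θ j‖ ≤ 1) → ∀ δ > 0, ∀ᶠ k in atTop,
      ‖∑' j, θ j * (Φ (p (φ k)) j - Φ q j)‖ ≤ 2 * r + δ := by
    intro θ hθ δ hδ
    -- An ultrafilter on the bad indices provides a genuine limit `q'` in `P`. It may differ from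
    -- `q`, but has the same coordinates; approximating by `w` at both `p (φ k)` and `q'` costs `2 *
    -- r`.
    by_contra hfr
    obtain ⟨w, hwc, hwr⟩ := hw θ hθ
    have := frequently_iff_neBot.1 (not_eventually.1 hfr)
    set l := atTop ⊓ 𝓟 {k | ¬‖∑' j, θ j * (Φ (p (φ k)) j - Φ q j)‖ ≤ 2 * r + δ}
    let 𝒰 := Ultrafilter.of l
    have h𝒰 : (𝒰 : Filter ℕ) ≤ l := Ultrafilter.of_le l
    obtain ⟨q', hq'⟩ : ∃ q', Tendsto (fun k => p (φ k)) 𝒰 (𝓝 q') :=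
      ⟨_, (𝒰.map fun k => p (φ k)).le_nhds_lim⟩
    have heq : ∀ j, Φ q' j = Φ q j := fun j =>
      tendsto_nhds_unique (((hΦ j).tendsto q').comp hq')
        ((hlim' j).mono_left (h𝒰.trans inf_le_left))
    have hwlim : Tendsto (fun k => ‖w (p (φ k)) - w q'‖) 𝒰 (𝓝 0) := by
      simpa using (((hwc.tendsto q').comp hq').sub_const (w q')).norm
    obtain ⟨k, hk1, hk2⟩ := ((hwlim.eventually_le_const hδ).and
      (h𝒰 (mem_inf_of_right (mem_principal_self _)))).exists
    refine hk2 ?_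
    have hsp := fun p' => (summable_mul_of_norm_le_one (hΦs p') hθ).of_norm
    have hsplit : ∑' j, θ j * (Φ (p (φ k)) j - Φ q j)
        = (∑' j, θ j * Φ (p (φ k)) j - w (p (φ k))) - (∑' j, θ j * Φ q' j - w q')
          + (w (p (φ k)) - w q') := by
      simp_rw [← heq, mul_sub]
      rw [(hsp _).tsum_sub (hsp _)]
      ring
    rw [hsplit]
    refine (norm_add_le _ _).trans (add_le_add ((norm_sub_le _ _).trans ?_) hk1)
    rw [two_mul]
    exact add_le_add (hwr _) (hwr _)
  have hschur := eventually_tsum_norm_le _ hcs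
    (fun j => by simpa using (hlim' j).sub_const (Φ q j)) hs (half_pos hε)
  have htail : Tendsto (fun k => ∑' j, ‖Φ q (j + φ k)‖) atTop (𝓝 0) :=
    (tendsto_sum_nat_add fun j => ‖Φ q j‖).comp hφ.tendsto_atTop
  obtain ⟨k, hk1, hk2⟩ := (hschur.and (htail.eventually_le_const (half_pos hε))).exists
  have hshift : ∑' j, ‖Φ (p (φ k)) (j + φ k) - Φ q (j + φ k)‖
      ≤ ∑' j, ‖Φ (p (φ k)) j - Φ q j‖ := by
    rw [← (hcs k).sum_add_tsum_nat_add (φ k)]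
    exact le_add_of_nonneg_left (Finset.sum_nonneg fun _ _ => norm_nonneg _)
  have hsum : ∑' j, ‖Φ (p (φ k)) (j + φ k)‖
      ≤ ∑' j, ‖Φ (p (φ k)) (j + φ k) - Φ q (j + φ k)‖ + ∑' j, ‖Φ q (j + φ k)‖ := by
    have h1 := (summable_nat_add_iff (φ k)).2 (hcs k)
    have h2 := (summable_nat_add_iff (φ k)).2 (hΦs q)
    rw [← h1.tsum_add h2]
    refine ((summable_nat_add_iff (φ k)).2 (hΦs _)).tsum_le_tsum (fun j => ?_) (h1.add h2)
    simpa using norm_add_le (Φ (p (φ k)) (j + φ k) - Φ q (j + φ k)) (Φ q (j + φ k))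
  have := hp (φ k)
  linarith

lemma dist_partialSum_le {a : ℕ → 𝕜} (ha : Summable fun j => ‖a j‖) {N m n : ℕ} (hm : N ≤ m)
    (hn : N ≤ n) :
    dist (∑ i ∈ Finset.range (m + 1), a i) (∑ i ∈ Finset.range (n + 1), a i)
      ≤ ∑' j, ‖a (j + N)‖ := by
  wlog hmn : m ≤ n generalizing m n
  · rw [dist_comm]
    exact this hn hm (le_of_not_ge hmn)
  rw [dist_comm, dist_eq_norm, ← Finset.sum_Ico_eq_sub _ (Nat.succ_le_succ hmn)]
  calc ‖∑ i ∈ Finset.Ico (m + 1) (n + 1), a i‖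
      ≤ ∑ i ∈ Finset.Ico (m + 1) (n + 1), ‖a i‖ := norm_sum_le _ _
    _ ≤ ∑ i ∈ Finset.Ico N (n + 1), ‖a i‖ :=
        Finset.sum_le_sum_of_subset_of_nonneg (Finset.Ico_subset_Ico (by omega) le_rfl)
          fun _ _ _ => norm_nonneg _
    _ = ∑ i ∈ Finset.range (n + 1 - N), ‖a (i + N)‖ := by
        rw [Finset.sum_Ico_eq_sum_range]
        simp_rw [add_comm N]
    _ ≤ _ := ((summable_nat_add_iff N).2 ha).sum_le_tsum _ fun _ _ => norm_nonneg _

end Sequences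

/-! ### Elementary estimates for extended distances -/

/-- Passing to finite `c` strictly above an infimum makes actual approximants available. -/
lemma le_mul_of_forall_nnreal_gt {a b m : ℝ≥0∞} (hm : m ≠ 0) (hm' : m ≠ ∞)
    (h : ∀ c : NNReal, b < c → a ≤ m * c) : a ≤ m * b := by
  rw [mul_comm, ← ENNReal.div_le_iff hm hm']
  refine le_of_forall_gt_imp_ge_of_dense fun c hc => ?_
  induction c with
  | top => exact le_top
  | coe c =>
    rw [ENNReal.div_le_iff hm hm', mul_comm]
    exact h c hc

section Sets

variable {M : Type*} [PseudoEMetricSpace M]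

lemma exists_edist_lt {A K : Set M} {c : ℝ≥0∞} (h : hausdorffExcess A K < c) {a : M}
    (ha : a ∈ A) : ∃ k ∈ K, edist a k < c :=
  Metric.infEDist_lt_iff.1 ((le_iSup₂ (f := fun a _ => Metric.infEDist a K) a ha).trans_lt h)

lemma hausdorffExcess_mono_left {A B K : Set M} (h : A ⊆ B) :
    hausdorffExcess A K ≤ hausdorffExcess B K :=
  biSup_mono fun _ ha => h ha

lemma infEDist_le_hausdorffExcess {A K : Set M} {a : M} (ha : a ∈ A) :
    Metric.infEDist a K ≤ hausdorffExcess A K :=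
  le_iSup₂ (f := fun a _ => Metric.infEDist a K) a ha

end Sets

lemma ca_le_ofReal {M : Type*} [PseudoMetricSpace M] {x : ℕ → M} {s : ℝ}
    (h : ∀ ε > 0, ∃ N, ∀ k, N ≤ k → ∀ l, N ≤ l → dist (x k) (x l) ≤ s + ε) :
    ca x ≤ ENNReal.ofReal s := by
  refine ENNReal.le_of_forall_pos_le_add fun ε hε _ => ?_
  obtain ⟨N, hN⟩ := h ε (NNReal.coe_pos.2 hε)
  refine (iInf_le _ N).trans (iSup₂_le fun k hk => iSup₂_le fun l hl => ?_)
  rw [edist_dist]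
  refine (ENNReal.ofReal_le_ofReal (hN k hk l hl)).trans (ENNReal.ofReal_add_le.trans ?_)
  simp

/-! ### Weak topologies and measures of weak non-compactness -/

section NormedSpace

variable (𝕜 : Type*) [RCLike 𝕜] {E : Type*} [NormedAddCommGroup E] [NormedSpace 𝕜 E]

lemma continuous_weakSpace_eval (g : StrongDual 𝕜 E) :
    Continuous fun v : WeakSpace 𝕜 E => g ((toWeakSpace 𝕜 E).symm v) :=
  WeakBilin.eval_continuous (topDualPairing 𝕜 E).flip g

lemma _root_.IsCompact.isWeaklyCompact {K : Set E} (hK : IsCompact K) : IsWeaklyCompact 𝕜 K :=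
  hK.image (toWeakSpaceCLM 𝕜 E).continuous

variable {𝕜}

lemma RightCauchy.weaklyCauchy {x : ℕ → E} (hx : RightCauchy 𝕜 x) : WeaklyCauchy 𝕜 x := fun f =>
  (hx {f} ((isCompact_singleton).isWeaklyCompact 𝕜)).cauchySeq (Set.mem_singleton f)

variable (𝕜)

lemma omegaSet_mono {A B : Set E} (h : A ⊆ B) : omegaSet 𝕜 A ≤ omegaSet 𝕜 B :=
  iInf_mono fun _ => iInf_mono fun _ => iInf_mono fun _ => hausdorffExcess_mono_left h

lemma omegaSet_le_chiSet (A : Set E) : omegaSet 𝕜 A ≤ chiSet A :=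
  iInf_mono fun _ => iInf_mono fun _ => le_iInf fun hK => iInf_le _ (hK.isWeaklyCompact 𝕜)

lemma omegaSet_le_hausdorffExcess {A K : Set E} (hne : K.Nonempty) (hK : IsWeaklyCompact 𝕜 K) :
    omegaSet 𝕜 A ≤ hausdorffExcess A K :=
  iInf_le_of_le K (iInf₂_le hne hK)

/-- The finite set of terms up to index `n` serves as `K`; each later term is compared with `x n`.
-/
lemma omegaSet_range_le_ca (x : ℕ → E) : omegaSet 𝕜 (Set.range x) ≤ ca x := by
  refine le_iInf fun n => ?_
  have hfin : (x '' Set.Iic n).Finite := (Set.finite_Iic n).image x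
  have hne : (x '' Set.Iic n).Nonempty := ⟨x n, n, Set.self_mem_Iic, rfl⟩
  refine (omegaSet_le_hausdorffExcess 𝕜 hne (hfin.isCompact.isWeaklyCompact 𝕜)).trans ?_
  refine iSup₂_le ?_
  rintro _ ⟨k, rfl⟩
  rcases le_total k n with hk | hk
  · rw [Metric.infEDist_zero_of_mem (Set.mem_image_of_mem x (Set.mem_Iic.2 hk))]
    exact zero_le
  · exact (Metric.infEDist_le_edist_of_mem (Set.mem_image_of_mem x Set.self_mem_Iic)).trans
      (le_iSup₂_of_le k hk (le_iSup₂_of_le n le_rfl le_rfl))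

open scoped Pointwise in
/-- A bounded neighbourhood of a weakly compact set stays weak-star closed in the bidual. -/
lemma isClosed_image_add_closedBall {K : Set E} (hK : IsWeaklyCompact 𝕜 K) (R : ℝ) :
    IsClosed (StrongDual.toWeakDual '' (NormedSpace.inclusionInDoubleDual 𝕜 E '' K) +
      WeakDual.toStrongDual ⁻¹' Metric.closedBall (0 : StrongDual 𝕜 (StrongDual 𝕜 E)) R) := by
  -- The canonical embedding is weak-to-weak-star continuous, and the ball is weak-star compact by
  -- Banach–Alaoglu; a sum of compact sets is compact.
  have hcomp : IsCompact
      (StrongDual.toWeakDual '' (NormedSpace.inclusionInDoubleDual 𝕜 E '' K)) := by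
    have := hK.image (NormedSpace.inclusionInDoubleDualWeak 𝕜 E).continuous
    rw [Set.image_image] at this ⊢
    exact this
  exact (hcomp.add (WeakDual.isCompact_closedBall 0 R)).isClosed

-- If `A` lies within `c` of a weakly compact `K`, then `A` is contained in `K + c B` with `B` the
-- bidual ball. This set is weak-star closed, so the closure of `A` stays within `c` of `K`, hence
-- of `E`.
open scoped Pointwise in
lemma wkSet_le_omegaSet (A : Set E) : wkSet 𝕜 A ≤ omegaSet 𝕜 A := by
  refine le_iInf fun K => le_iInf fun _ => le_iInf fun hK => ?_
  refine iSup₂_le fun z hz => le_of_forall_gt_imp_ge_of_dense fun c hc => ?_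
  induction c with
  | top => exact le_top
  | coe c =>
    have hsub : StrongDual.toWeakDual '' (NormedSpace.inclusionInDoubleDual 𝕜 E '' A) ⊆
        StrongDual.toWeakDual '' (NormedSpace.inclusionInDoubleDual 𝕜 E '' K) +
        WeakDual.toStrongDual ⁻¹' Metric.closedBall (0 : StrongDual 𝕜 (StrongDual 𝕜 E)) c := by
      rintro _ ⟨_, ⟨a, ha, rfl⟩, rfl⟩
      obtain ⟨k, hk, hak⟩ := exists_edist_lt hc ha
      refine ⟨_, ⟨_, ⟨k, hk, rfl⟩, rfl⟩,
        StrongDual.toWeakDual (NormedSpace.inclusionInDoubleDual 𝕜 E (a - k)), ?_, ?_⟩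
      · have hnorm : ‖NormedSpace.inclusionInDoubleDual 𝕜 E (a - k)‖ ≤ c := by
          refine (NormedSpace.double_dual_bound 𝕜 E (a - k)).trans ?_
          rw [← dist_eq_norm]
          rw [edist_nndist] at hak
          exact_mod_cast hak.le
        exact (mem_closedBall_zero_iff (E := StrongDual 𝕜 (StrongDual 𝕜 E))).2 hnorm
      · simp only [map_sub, add_sub_cancel]
    obtain ⟨_, ⟨_, ⟨k, hk, rfl⟩, rfl⟩, b, hb, hz'⟩ :=
      closure_minimal hsub (isClosed_image_add_closedBall 𝕜 hK c) hz
    have hzb : z - NormedSpace.inclusionInDoubleDual 𝕜 E k = WeakDual.toStrongDual b := by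
      ext f
      have hzf : z f = f k + b f := congrArg (fun w : StrongDual 𝕜 (StrongDual 𝕜 E) => w f) hz'.symm
      simp [hzf]
    refine (Metric.infEDist_le_edist_of_mem (Set.mem_range_self k)).trans ?_
    rw [edist_eq_enorm_sub, hzb, enorm_le_coe]
    exact mem_closedBall_zero_iff.1 hb

lemma infEDist_canonicalCopy_le_wkSet {A : Set E} {y : ℕ → E} (hy : ∀ n, y n ∈ A)
    {z : StrongDual 𝕜 (StrongDual 𝕜 E)} (hz : IsWeakStarLim 𝕜 y z) :
    Metric.infEDist z (canonicalCopy 𝕜 E) ≤ wkSet 𝕜 A := by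
  have hmem : StrongDual.toWeakDual z ∈
      closure (StrongDual.toWeakDual '' (NormedSpace.inclusionInDoubleDual 𝕜 E '' A)) :=
    mem_closure_of_tendsto hz (Eventually.of_forall fun n => ⟨_, ⟨y n, hy n, rfl⟩, rfl⟩)
  exact infEDist_le_hausdorffExcess hmem

variable {𝕜}

/-- The constant splits as `2 c + 2 c`. If far-out pairs stay apart, their approximants subconverge
to `v` and `w`. Functionals lose sight of `x k - x l` in the limit, so `‖v - w‖ ≤ 2 c`; returning
from approximants to the sequence costs another `2 c`. -/
lemma WeaklyCauchy.ca_le_of_approx {x : ℕ → E} (hx : WeaklyCauchy 𝕜 x) {K : Set E}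
    (hK : IsCompact K) {c : ℝ} (hKx : ∀ n, ∃ k ∈ K, dist (x n) k ≤ c) :
    ca x ≤ ENNReal.ofReal (4 * c) := by
  refine ca_le_ofReal fun ε hε => ?_
  by_contra! hcon
  choose u huK hu using hKx
  choose k hk l hl hkl using hcon
  obtain ⟨⟨v, w⟩, -, φ, hφ, hlim⟩ := (hK.prod hK).tendsto_subseq
    (x := fun n => (u (k n), u (l n))) fun n => ⟨huK _, huK _⟩
  have hv : Tendsto (fun n => u (k (φ n)) - u (l (φ n))) atTop (𝓝 (v - w)) :=
    ((continuous_fst.tendsto _).comp hlim).sub ((continuous_snd.tendsto _).comp hlim)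
  have hkφ : Tendsto (fun n => k (φ n)) atTop atTop :=
    (tendsto_atTop_mono hk tendsto_id).comp hφ.tendsto_atTop
  have hlφ : Tendsto (fun n => l (φ n)) atTop atTop :=
    (tendsto_atTop_mono hl tendsto_id).comp hφ.tendsto_atTop
  have hc : 0 ≤ c := dist_nonneg.trans (hu 0)
  have hvw : ‖v - w‖ ≤ 2 * c := by
    refine NormedSpace.norm_le_dual_bound 𝕜 _ (by positivity) fun f => ?_
    have h1 : Tendsto (fun n => 2 * c * ‖f‖ + dist (f (x (k (φ n)))) (f (x (l (φ n))))) atTop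
        (𝓝 (2 * c * ‖f‖ + 0)) := by
      refine tendsto_const_nhds.add ?_
      obtain ⟨t, ht⟩ := cauchySeq_tendsto_of_complete (hx f)
      simpa using (ht.comp hkφ).dist (ht.comp hlφ)
    rw [add_zero] at h1
    refine le_of_tendsto_of_tendsto' ((f.continuous.tendsto _).comp hv).norm h1 fun n => ?_
    have hd : f (u (k (φ n)) - u (l (φ n)))
        = f ((u (k (φ n)) - x (k (φ n))) - (u (l (φ n)) - x (l (φ n))))
          + (f (x (k (φ n))) - f (x (l (φ n)))) := by
      simp only [map_sub]; ring
    simp only [Function.comp_apply]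
    rw [hd, dist_eq_norm]
    refine (norm_add_le _ _).trans (add_le_add_left ((f.le_opNorm _).trans ?_) _)
    rw [mul_comm]
    refine mul_le_mul_of_nonneg_right ((norm_sub_le _ _).trans ?_) (norm_nonneg _)
    rw [← dist_eq_norm, ← dist_eq_norm, dist_comm, dist_comm (u _), two_mul]
    exact add_le_add (hu _) (hu _)
  have hfin : 4 * c + ε ≤ 2 * c + ‖v - w‖ := by
    refine ge_of_tendsto' (tendsto_const_nhds.add hv.norm) fun n => ?_
    have h3 := dist_triangle4 (x (k (φ n))) (u (k (φ n))) (u (l (φ n))) (x (l (φ n)))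
    have h4 := hkl (φ n)
    have h5 := hu (k (φ n))
    have h6 := hu (l (φ n))
    rw [dist_comm] at h6
    rw [dist_eq_norm (u (k (φ n)))] at h3
    linarith
  linarith

end NormedSpace

/-! ### Weakly unconditionally Cauchy series -/

section Series

variable {𝕜 : Type*} [RCLike 𝕜] {E : Type*} [NormedAddCommGroup E] [NormedSpace 𝕜 E]
  {F : Type*} [NormedAddCommGroup F] [NormedSpace 𝕜 F]

variable (𝕜) in
/-- The series `∑ x n` is weakly unconditionally Cauchy, with constant `C`. -/
structure IsWUC (C : ℝ) (x : ℕ → E) : Prop where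
  summable (f : StrongDual 𝕜 E) : Summable fun n => ‖f (x n)‖
  tsum_le (f : StrongDual 𝕜 E) : ∑' n, ‖f (x n)‖ ≤ C * ‖f‖

lemma isWUC_of_iSup_le_one {x : ℕ → E}
    (h : (⨆ (f : StrongDual 𝕜 E) (_ : ‖f‖ ≤ 1), ∑' n, ‖f (x n)‖ₑ) ≤ 1) : IsWUC 𝕜 1 x := by
  have key : ∀ f : StrongDual 𝕜 E, ‖f‖ ≤ 1 →
      Summable (fun n => ‖f (x n)‖) ∧ ∑' n, ‖f (x n)‖ ≤ 1 := by
    intro f hf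
    have h1 : ∑' n, ‖f (x n)‖ₑ ≤ 1 :=
      (le_iSup₂ (f := fun (f : StrongDual 𝕜 E) (_ : ‖f‖ ≤ 1) => ∑' n, ‖f (x n)‖ₑ) f hf).trans h
    simp_rw [← ofReal_norm] at h1
    have hs : Summable fun n => ‖f (x n)‖ := by
      have := ENNReal.summable_toReal (ne_top_of_le_ne_top ENNReal.one_ne_top h1)
      simpa using this
    refine ⟨hs, ?_⟩
    rw [← ENNReal.ofReal_tsum_of_nonneg (fun _ => norm_nonneg _) hs] at h1
    exact ENNReal.ofReal_le_one.1 h1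
  have scaled : ∀ f : StrongDual 𝕜 E,
      Summable (fun n => ‖f (x n)‖) ∧ ∑' n, ‖f (x n)‖ ≤ 1 * ‖f‖ := by
    intro f
    rcases eq_or_ne f 0 with rfl | hf
    · simp [summable_zero]
    have hf' : 0 < ‖f‖ := norm_pos_iff.2 hf
    obtain ⟨h1, h2⟩ := key (((‖f‖⁻¹ : ℝ) : 𝕜) • f) (by simp [norm_smul, hf'.ne'])
    have heq : ∀ n, ‖(((‖f‖⁻¹ : ℝ) : 𝕜) • f) (x n)‖ = ‖f‖⁻¹ * ‖f (x n)‖ := fun n => by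
      simp
    simp_rw [heq] at h1 h2
    rw [summable_mul_left_iff (inv_ne_zero hf'.ne')] at h1
    rw [tsum_mul_left, inv_mul_le_iff₀ hf', mul_one] at h2
    exact ⟨h1, by rwa [one_mul]⟩
  exact ⟨fun f => (scaled f).1, fun f => (scaled f).2⟩

namespace IsWUC

variable {C : ℝ} {x : ℕ → E}

lemma map (hx : IsWUC 𝕜 C x) (hC : 0 ≤ C) (T : E →L[𝕜] F) :
    IsWUC 𝕜 (C * ‖T‖) fun n => T (x n) where
  summable f := hx.summable (f.comp T)
  tsum_le f := by
    refine (hx.tsum_le (f.comp T)).trans ?_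
    rw [mul_assoc, mul_comm ‖T‖]
    exact mul_le_mul_of_nonneg_left (f.opNorm_comp_le T) hC

lemma smul (hx : IsWUC 𝕜 C x) {θ : ℕ → 𝕜} (hθ : ∀ j, ‖θ j‖ ≤ 1) :
    IsWUC 𝕜 C fun n => θ n • x n where
  summable f := by
    simpa using summable_mul_of_norm_le_one (hx.summable f) hθ
  tsum_le f := by
    refine (Summable.tsum_le_tsum (fun n => ?_) ?_ (hx.summable f)).trans (hx.tsum_le f)
    · rw [map_smul, norm_smul]
      exact mul_le_of_le_one_left (norm_nonneg _) (hθ n)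
    · simpa using summable_mul_of_norm_le_one (hx.summable f) hθ

lemma norm_sum_le (hx : IsWUC 𝕜 C x) (hC : 0 ≤ C) (s : Finset ℕ) : ‖∑ i ∈ s, x i‖ ≤ C := by
  refine NormedSpace.norm_le_dual_bound 𝕜 _ hC fun f => ?_
  rw [map_sum]
  exact (_root_.norm_sum_le _ _).trans
    (((hx.summable f).sum_le_tsum s fun _ _ => norm_nonneg _).trans (hx.tsum_le f))

/-- The sum of a weakly unconditionally Cauchy series, in the bidual. -/
noncomputable def bidualSum (hx : IsWUC 𝕜 C x) : StrongDual 𝕜 (StrongDual 𝕜 E) :=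
  LinearMap.mkContinuous
    { toFun := fun f => ∑' n, f (x n)
      map_add' := fun f g => (hx.summable f).of_norm.tsum_add (hx.summable g).of_norm
      map_smul' := fun _ _ => tsum_mul_left } C
    fun f => (norm_tsum_le_tsum_norm (hx.summable f)).trans (hx.tsum_le f)

lemma bidualSum_apply (hx : IsWUC 𝕜 C x) (f : StrongDual 𝕜 E) :
    hx.bidualSum f = ∑' n, f (x n) := rfl

lemma isWeakStarLim (hx : IsWUC 𝕜 C x) :
    IsWeakStarLim 𝕜 (fun n => ∑ i ∈ Finset.range (n + 1), x i) hx.bidualSum := by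
  refine tendsto_iff_forall_eval_tendsto_topDualPairing.2 fun f => ?_
  have h := ((hx.summable f).of_norm.hasSum.tendsto_sum_nat).comp (tendsto_add_atTop_nat 1)
  refine h.congr fun n => ?_
  exact (map_sum f _ _).symm

/-- The partial sums of a weakly unconditionally Cauchy series are Right-Cauchy. -/
theorem rightCauchy (hx : IsWUC 𝕜 C x) :
    RightCauchy 𝕜 fun n => ∑ i ∈ Finset.range (n + 1), x i := by
  intro K hK
  have := isCompact_iff_compactSpace.1 hK
  let Φ : (toWeakSpace 𝕜 (StrongDual 𝕜 E) '' K) → ℕ → 𝕜 := fun p j =>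
    (toWeakSpace 𝕜 (StrongDual 𝕜 E)).symm p (x j)
  rw [Metric.uniformCauchySeqOn_iff]
  intro ε hε
  -- Each signed sum is an element of the bidual, hence itself weakly continuous on the dual; no
  -- approximation error occurs and `r = 0`.
  obtain ⟨N, hN⟩ := exists_forall_tsum_tail_le (r := 0) Φ
    (fun j => (continuous_weakSpace_eval 𝕜
      (NormedSpace.inclusionInDoubleDual 𝕜 E (x j))).comp continuous_subtype_val)
    (fun p => hx.summable _)
    (fun θ hθ => ⟨fun p => (hx.smul hθ).bidualSum ((toWeakSpace 𝕜 (StrongDual 𝕜 E)).symm p),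
      (continuous_weakSpace_eval 𝕜 _).comp continuous_subtype_val, fun p => by
        simp [bidualSum_apply, Φ]⟩) (half_pos hε)
  refine ⟨N, fun m hm n hn f hf => ?_⟩
  have h := hN ⟨_, f, hf, rfl⟩
  simp only [map_sum]
  refine ((dist_partialSum_le (hx.summable f) hm hn).trans h).trans_lt ?_
  linarith

/-- If all signed sums of the series are within `r` of the space, then the partial sums are
`2 r`-Cauchy. -/
theorem ca_partialSum_le (hx : IsWUC 𝕜 C x) {r : NNReal}
    (hr : ∀ (θ : ℕ → 𝕜) (hθ : ∀ j, ‖θ j‖ ≤ 1),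
      Metric.infEDist (hx.smul hθ).bidualSum (canonicalCopy 𝕜 E) < r) :
    ca (fun n => ∑ i ∈ Finset.range (n + 1), x i) ≤ 2 * r := by
  have hcomp := WeakDual.isCompact_closedBall (0 : StrongDual 𝕜 E) 1
  have := isCompact_iff_compactSpace.1 hcomp
  let P := (WeakDual.toStrongDual ⁻¹' Metric.closedBall (0 : StrongDual 𝕜 E) 1 :
    Set (WeakDual 𝕜 E))
  let Φ : P → ℕ → 𝕜 := fun p j => (p : WeakDual 𝕜 E) (x j)
  have hca : ca (fun n => ∑ i ∈ Finset.range (n + 1), x i) ≤ ENNReal.ofReal (2 * r) := by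
    refine ca_le_ofReal fun ε hε => ?_
    -- A signed sum in the bidual need not be weak-star continuous on the dual ball, so evaluation
    -- at a point `y` of `E` within `r` of it takes its place.
    obtain ⟨N, hN⟩ := exists_forall_tsum_tail_le (r := r) Φ
      (fun j => (WeakDual.eval_continuous (x j)).comp continuous_subtype_val)
      (fun p => hx.summable (WeakDual.toStrongDual (p : WeakDual 𝕜 E)))
      (fun θ hθ => by
        obtain ⟨_, ⟨y, rfl⟩, hy⟩ := Metric.infEDist_lt_iff.1 (hr θ hθ)
        refine ⟨fun p => (p : WeakDual 𝕜 E) y,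
          (WeakDual.eval_continuous y).comp continuous_subtype_val, fun p => ?_⟩
        have hp : ‖WeakDual.toStrongDual (p : WeakDual 𝕜 E)‖ ≤ 1 := mem_closedBall_zero_iff.1 p.2
        have heq : ∑' j, θ j * Φ p j - (p : WeakDual 𝕜 E) y =
            ((hx.smul hθ).bidualSum - NormedSpace.inclusionInDoubleDual 𝕜 E y)
              (WeakDual.toStrongDual (p : WeakDual 𝕜 E)) := by
          simp [bidualSum_apply, Φ]
        rw [heq]
        refine (ContinuousLinearMap.unit_le_opNorm _ _ hp).trans ?_
        rw [edist_nndist] at hy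
        rw [← dist_eq_norm]
        exact_mod_cast hy.le) hε
    refine ⟨N, fun k hk l hl => ?_⟩
    obtain ⟨g, hg, hgv⟩ := exists_dual_vector'' 𝕜
      (∑ i ∈ Finset.range (k + 1), x i - ∑ i ∈ Finset.range (l + 1), x i)
    have h := hN ⟨StrongDual.toWeakDual g, mem_closedBall_zero_iff.2 hg⟩
    refine le_trans ?_ h
    refine le_trans (le_of_eq ?_) (dist_partialSum_le (hx.summable g) hk hl)
    rw [dist_eq_norm, dist_eq_norm, ← map_sum, ← map_sum, ← map_sub, hgv, RCLike.norm_ofReal,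
      abs_of_nonneg (norm_nonneg _)]
  refine hca.trans (le_of_eq ?_)
  rw [ENNReal.ofReal_mul zero_le_two]
  simp

end IsWUC

end Series

/-! ### Comparison of the operator quantities -/

section Operators

variable {𝕜 : Type*} [RCLike 𝕜]
  {X : Type*} [NormedAddCommGroup X] [NormedSpace 𝕜 X]
  {Y : Type*} [NormedAddCommGroup Y] [NormedSpace 𝕜 Y] (T : X →L[𝕜] Y)

lemma mem_ballImage {x : X} (hx : ‖x‖ ≤ 1) : T x ∈ ballImage T := ⟨x, hx, rfl⟩

/-- Partial sums of every signed series stay in the unit ball and are Right-Cauchy, so `rcc T`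
controls the distance to `Y` of each signed sum of `∑ T x j`. -/
theorem uc_le_two_mul_rcc : uc T ≤ 2 * rcc T := by
  refine iSup₂_le fun x hx => le_mul_of_forall_nnreal_gt two_ne_zero ENNReal.ofNat_ne_top
    fun r hr => ?_
  have hw := isWUC_of_iSup_le_one hx
  refine (hw.map zero_le_one T).ca_partialSum_le fun θ hθ => lt_of_le_of_lt ?_ hr
  have hθw := hw.smul hθ
  refine le_iSup_of_le (fun n => ∑ i ∈ Finset.range (n + 1), θ i • x i) (le_iSup_of_le
    (fun n => hθw.norm_sum_le zero_le_one _) (le_iSup_of_le hθw.rightCauchy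
      (le_iSup₂_of_le _ ?_ le_rfl)))
  simpa using ((hw.map zero_le_one T).smul hθ).isWeakStarLim

/-- A norming functional `g` has `adj T g` within `c` of some `h` in the weakly compact `K`. The
Right-Cauchy property handles `h` uniformly, while the error acts on `x k - x l`, of norm at most
`2`. -/
theorem ccRho_le_two_mul_omega_adj : ccRho T ≤ 2 * omega (adj T) := by
  refine iSup_le fun x => iSup_le fun hx => iSup_le fun hR =>
    le_mul_of_forall_nnreal_gt two_ne_zero ENNReal.ofNat_ne_top fun c hc => ?_
  simp only [omega, omegaSet, iInf_lt_iff] at hc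
  obtain ⟨K, -, hK, hKc⟩ := hc
  have hca : ca (fun n => T (x n)) ≤ ENNReal.ofReal (2 * c) := by
    refine ca_le_ofReal fun ε hε => ?_
    obtain ⟨N, hN⟩ := Metric.uniformCauchySeqOn_iff.1 (hR K hK) ε hε
    refine ⟨N, fun k hk l hl => ?_⟩
    obtain ⟨g, hg, hgv⟩ := exists_dual_vector'' 𝕜 (T (x k) - T (x l))
    obtain ⟨h, hhK, hgh⟩ := exists_edist_lt hKc (mem_ballImage (adj T) hg)
    have hgh' : ‖adj T g - h‖ ≤ c := by
      rw [edist_nndist] at hgh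
      rw [← dist_eq_norm]
      exact_mod_cast hgh.le
    have heq : g (T (x k) - T (x l)) = (adj T g - h) (x k - x l) + (h (x k) - h (x l)) := by
      simp [adj]
    have hxkl : ‖x k - x l‖ ≤ 2 := (norm_sub_le _ _).trans (by linarith [hx k, hx l])
    calc dist (T (x k)) (T (x l)) = ‖g (T (x k) - T (x l))‖ := by
          rw [hgv, RCLike.norm_ofReal, abs_of_nonneg (norm_nonneg _), dist_eq_norm]
      _ ≤ ‖(adj T g - h) (x k - x l)‖ + ‖h (x k) - h (x l)‖ := heq ▸ norm_add_le _ _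
      _ ≤ c * 2 + ε := by
          refine add_le_add (ContinuousLinearMap.le_of_opNorm_le_of_le _ hgh' hxkl) ?_
          rw [← dist_eq_norm]
          exact (hN k hk l hl h hhK).le
      _ = _ := by ring
  refine hca.trans (le_of_eq ?_)
  rw [ENNReal.ofReal_mul zero_le_two]
  simp

theorem cc_le_four_mul_chi : cc T ≤ 4 * chi T := by
  refine iSup_le fun x => iSup_le fun hx => iSup_le fun hW =>
    le_mul_of_forall_nnreal_gt four_ne_zero ENNReal.ofNat_ne_top fun c hc => ?_
  simp only [chi, chiSet, iInf_lt_iff] at hc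
  obtain ⟨K, -, hK, hKc⟩ := hc
  have hTW : WeaklyCauchy 𝕜 fun n => T (x n) := fun f => hW (f.comp T)
  refine (hTW.ca_le_of_approx hK (c := c) fun n => ?_).trans (le_of_eq ?_)
  · obtain ⟨k, hk, h⟩ := exists_edist_lt hKc (mem_ballImage T (hx n))
    rw [edist_nndist] at h
    exact ⟨k, hk, by exact_mod_cast h.le⟩
  · rw [ENNReal.ofReal_mul zero_le_four]
    simp

theorem rcc_le_rccOmega : rcc T ≤ rccOmega T :=
  iSup_mono fun _ => iSup_mono fun _ => iSup_mono fun _ => iSup₂_le fun _ hz =>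
    (infEDist_canonicalCopy_le_wkSet 𝕜 Set.mem_range_self hz).trans (wkSet_le_omegaSet 𝕜 _)

theorem wcc_le_wccOmega : wcc T ≤ wccOmega T :=
  iSup_mono fun _ => iSup_mono fun _ => iSup_mono fun _ => iSup₂_le fun _ hz =>
    (infEDist_canonicalCopy_le_wkSet 𝕜 Set.mem_range_self hz).trans (wkSet_le_omegaSet 𝕜 _)

theorem wcc_le_wk : wcc T ≤ wk T :=
  iSup_le fun _ => iSup_le fun hx => iSup_le fun _ => iSup₂_le fun _ hz =>
    infEDist_canonicalCopy_le_wkSet 𝕜 (fun n => mem_ballImage T (hx n)) hz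

theorem wccOmega_le_omega : wccOmega T ≤ omega T :=
  iSup_le fun _ => iSup_le fun hx => iSup_le fun _ => omegaSet_mono 𝕜 <| by
    rintro _ ⟨n, rfl⟩
    exact mem_ballImage T (hx n)

end Operators

end OperatorQuantity

theorem theorem5p1 {𝕜 : Type*} [RCLike 𝕜]
    {X : Type*} [NormedAddCommGroup X] [NormedSpace 𝕜 X] [CompleteSpace X]
    {Y : Type*} [NormedAddCommGroup Y] [NormedSpace 𝕜 Y] [CompleteSpace Y]
    (T : X →L[𝕜] Y) :
    -- top row and what lies above it
    OperatorQuantity.ccRho T ≤ 2 * OperatorQuantity.omega (OperatorQuantity.adj T) ∧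
    OperatorQuantity.ccRho T ≤ OperatorQuantity.cc T ∧
    OperatorQuantity.cc T ≤ 4 * OperatorQuantity.chi T ∧
    -- from the middle row to the top row
    OperatorQuantity.rccOmega T ≤ OperatorQuantity.ccRho T ∧
    OperatorQuantity.wccOmega T ≤ OperatorQuantity.cc T ∧
    OperatorQuantity.omega T ≤ OperatorQuantity.chi T ∧
    -- middle row
    OperatorQuantity.rccOmega T ≤ OperatorQuantity.wccOmega T ∧
    OperatorQuantity.wccOmega T ≤ OperatorQuantity.omega T ∧
    -- from the bottom row to the middle row
    OperatorQuantity.rcc T ≤ OperatorQuantity.rccOmega T ∧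
    OperatorQuantity.wcc T ≤ OperatorQuantity.wccOmega T ∧
    OperatorQuantity.wk T ≤ OperatorQuantity.omega T ∧
    -- bottom row
    (1 / 4 : ℝ≥0∞) * OperatorQuantity.uc T ≤ OperatorQuantity.rcc T ∧
    OperatorQuantity.rcc T ≤ OperatorQuantity.wcc T ∧
    OperatorQuantity.wcc T ≤ OperatorQuantity.wk T := by
  open OperatorQuantity in
  refine ⟨ccRho_le_two_mul_omega_adj T, ?_, cc_le_four_mul_chi T, ?_, ?_,
    omegaSet_le_chiSet 𝕜 _, ?_, wccOmega_le_omega T, rcc_le_rccOmega T, wcc_le_wccOmega T,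
    wkSet_le_omegaSet 𝕜 _, ?_, ?_, wcc_le_wk T⟩
  · exact iSup_mono fun _ => iSup_mono fun _ => iSup_mono' fun hx => ⟨hx.weaklyCauchy, le_rfl⟩
  · exact iSup_mono fun _ => iSup_mono fun _ => iSup_mono fun _ => omegaSet_range_le_ca 𝕜 _
  · exact iSup_mono fun _ => iSup_mono fun _ => iSup_mono fun _ => omegaSet_range_le_ca 𝕜 _
  · exact iSup_mono fun _ => iSup_mono fun _ => iSup_mono' fun hx => ⟨hx.weaklyCauchy, le_rfl⟩
  -- The bound with factor two is stronger than required and is relaxed to factor four.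
  · have h4 : (4 : ℝ≥0∞) = 2 * 2 := by norm_num
    rw [one_div, mul_comm, ← div_eq_mul_inv]
    refine ENNReal.div_le_of_le_mul ((uc_le_two_mul_rcc T).trans ?_)
    rw [mul_comm]
    gcongr
    norm_num
  · exact iSup_mono fun _ => iSup_mono fun _ => iSup_mono' fun hx => ⟨hx.weaklyCauchy, le_rfl⟩
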